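/- Let $u>0$ and $\alpha>0$, and let $\rho$ be a probability distribution on $[1,\infty)$ for which there is a constant $c>0$ with $c^{-1}r^{-\alpha}\le \rho[r,\infty)\le c\,r^{-\alpha}$ for all $r\ge 1$. Let $\lambda$ be Lebesgue measure on $\mathbb{R}^2$, let $\nu$ be the uniform distribution on $(-\pi/2,\pi/2]$, and let $\xi$ be a Poisson point process on $S=\mathbb{R}^2\times[1,\infty)\times(-\pi/2,\pi/2]$ with intensity measure $(u\lambda)\otimes\rho\otimes\nu$. For $(z,R,V)\in S$ let $E(z,R,V)$ be the closed filled ellipse with center $z$, major semi-axis $R$ in the direction $(\cos V,\sin V)$, and minor semi-axis $1$. Let $\mathcal{E}=\bigcup_{s\in\operatorname{supp}\xi}E(s)$ be the covered set. Then: 1. $\mathcal{E}=\mathbb{R}^2$ almost surely if and only if $\alpha\le 1$. 2. For every $w\in\mathbb{R}^2$ and every $0\le\varepsilon<1/2$, the closed ball $B(w,\varepsilon)$ (with $B(w,0)=\{w\}$) satisfies $B(w,\varepsilon)\subset\mathcal{E}$ almost surely if and only if $\alpha\le 1$. In particular, whether these events have probability one does not depend on $u$. -/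

import Mathlib

open MeasureTheory ProbabilityTheory
open scoped ENNReal

namespace EllipsesModel

noncomputable section

/-- The Euclidean plane. -/
abbrev Plane : Type := EuclideanSpace ℝ (Fin 2)

/-- The parameter space `S = ℝ² × [1, ∞) × (-π/2, π/2]` of ellipses: center, half-length of the
major axis, direction of the major axis. -/
abbrev Params : Type :=
  Plane × Set.Ici (1 : ℝ) × Set.Ioc (-(Real.pi / 2)) (Real.pi / 2)

/-- A point measure: a countable sum `∑ i, δ_{x i}` of Dirac masses that is locally finite. -/
def IsPointMeasure {X : Type*} [TopologicalSpace X] [MeasurableSpace X] (m : Measure X) : Prop :=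
  (∃ (I : Set ℕ) (x : I → X), m = Measure.sum fun i => Measure.dirac (x i)) ∧
    IsLocallyFiniteMeasure m

/-- `ξ` is a Poisson point process on `X` with intensity measure `μ`, defined on the probability
space `(Ω, P)`: a random point measure whose number of points in `B` has the Poisson law of
parameter `μ B` (and is a.s. infinite if `μ B = ∞`), with independent numbers of points in
pairwise disjoint sets. -/
structure IsPoissonPointProcess {Ω X : Type*} [MeasurableSpace Ω] [TopologicalSpace X]
    [MeasurableSpace X] (ξ : Ω → Measure X) (μ : Measure X) (P : Measure Ω) : Prop where
  isPointMeasure : ∀ ω, IsPointMeasure (ξ ω)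
  measurable : Measurable ξ
  law_of_finite : ∀ B : Set X, MeasurableSet B → μ B ≠ ∞ →
    P.map (fun ω => ξ ω B) =
      (poissonMeasure (μ B).toNNReal).map (fun k : ℕ => (k : ℝ≥0∞))
  eq_top_of_infinite : ∀ B : Set X, MeasurableSet B → μ B = ∞ → ∀ᵐ ω ∂P, ξ ω B = ∞
  indep : ∀ (n : ℕ) (B : Fin n → Set X), (∀ i, MeasurableSet (B i)) →
    Pairwise (fun i j => Disjoint (B i) (B j)) → iIndepFun (fun i ω => ξ ω (B i)) P

/-- The probability law `ρ` on `[1, ∞)` has tail decay `α`: `ρ[r, ∞) ≍ r ^ (-α)` for `r ≥ 1`. -/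
def HasTailDecay (ρ : Measure (Set.Ici (1 : ℝ))) (α : ℝ) : Prop :=
  ∃ c : ℝ, 0 < c ∧ ∀ r : ℝ, 1 ≤ r →
    c⁻¹ * r ^ (-α) ≤ ρ.real {R | r ≤ (R : ℝ)} ∧ ρ.real {R | r ≤ (R : ℝ)} ≤ c * r ^ (-α)

/-- The uniform law of the direction of the major axis. -/
def directionLaw : Measure (Set.Ioc (-(Real.pi / 2)) (Real.pi / 2)) :=
  (ENNReal.ofReal Real.pi)⁻¹ • (volume : Measure ℝ).comap Subtype.val

/-- The intensity measure `(u λ) ⊗ ρ ⊗ ν` of the ellipses model. -/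
def intensity (u : ℝ) (ρ : Measure (Set.Ici (1 : ℝ))) : Measure Params :=
  (ENNReal.ofReal u • (volume : Measure Plane)).prod (ρ.prod directionLaw)

/-- The closed filled ellipse `E(z, R, V)` with center `z`, major semi-axis `R` in direction
`(cos V, sin V)`, and minor semi-axis `1`. -/
def ellipse (s : Params) : Set Plane :=
  {x | (((x 0 - s.1 0) * Real.cos s.2.2 + (x 1 - s.1 1) * Real.sin s.2.2) / (s.2.1 : ℝ)) ^ 2 +
      (-(x 0 - s.1 0) * Real.sin s.2.2 + (x 1 - s.1 1) * Real.cos s.2.2) ^ 2 ≤ 1}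

/-- The covered set `ℰ(ξ)`: the union of the ellipses whose parameters lie in the support of the
point measure. -/
def coveredSet (m : Measure Params) : Set Plane :=
  ⋃ s ∈ m.support, ellipse s

end

end EllipsesModel

namespace EllipsesModel

/-! Up to constants, the parameters of the ellipses containing a point `w` form a set `boxParams w
k`. Its sections in the center are rectangles of area `4 * k ^ 2 * R`, so its intensity is a
positive multiple of `∫ R dρ`, finite exactly when `1 < α` (`HasTailDecay.lintegral_lt_top_iff`). If
it is infinite, almost surely some ellipse covers a ball of fixed radius around `w`, and countably
many such balls fill the plane. If it is finite, with positive probability no ellipse reaches `w`.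
-/

/-- The coordinates of `x` in the frame rotated by the angle `v`. -/
noncomputable def rotatedCoord (v : ℝ) (x : Plane) : Fin 2 → ℝ :=
  ![x 0 * Real.cos v + x 1 * Real.sin v, -x 0 * Real.sin v + x 1 * Real.cos v]

theorem measurePreserving_rotatedCoord (v : ℝ) : MeasurePreserving (rotatedCoord v) := by
  set M : Matrix (Fin 2) (Fin 2) ℝ := !![Real.cos v, Real.sin v; -Real.sin v, Real.cos v] with hM
  have hdet : M.det = 1 := by
    rw [hM, Matrix.det_fin_two_of]
    linear_combination Real.sin_sq_add_cos_sq v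
  have h1 : MeasurePreserving (Matrix.toLin' M) := by
    refine ⟨(LinearMap.continuous_of_finiteDimensional _).measurable, ?_⟩
    rw [Real.map_matrix_volume_pi_eq_smul_volume_pi (by rw [hdet]; exact one_ne_zero), hdet]
    simp
  convert h1.comp (EuclideanSpace.volume_preserving_symm_measurableEquiv_toLp (Fin 2)) using 1
  funext x i
  fin_cases i <;>
    simp [rotatedCoord, hM, Matrix.mulVec, dotProduct, Fin.sum_univ_two, mul_comm]

/-- The parameters of the ellipses for which `w` lies in the open rectangle with the same center
and axes, whose half-sides are `k` times the semi-axes. -/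
def boxParams (w : Plane) (k : ℝ) : Set Params :=
  {s | |(w 0 - s.1 0) * Real.cos s.2.2 + (w 1 - s.1 1) * Real.sin s.2.2| < k * (s.2.1 : ℝ) ∧
    |-(w 0 - s.1 0) * Real.sin s.2.2 + (w 1 - s.1 1) * Real.cos s.2.2| < k}

theorem isOpen_boxParams (w : Plane) (k : ℝ) : IsOpen (boxParams w k) := by
  refine IsOpen.and (isOpen_lt ?_ ?_) (isOpen_lt ?_ ?_) <;> fun_prop

theorem volume_boxParams_section (w : Plane) (k : ℝ)
    (t : Set.Ici (1 : ℝ) × Set.Ioc (-(Real.pi / 2)) (Real.pi / 2)) :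
    volume ((fun z : Plane => ((z, t) : Params)) ⁻¹' boxParams w k) =
      ENNReal.ofReal (2 * k) * ENNReal.ofReal (2 * k) * ENNReal.ofReal (t.1 : ℝ) := by
  obtain ⟨⟨R, hR⟩, ⟨v, hv⟩⟩ := t
  have hR0 : (0 : ℝ) ≤ R := zero_le_one.trans hR
  have hset : ((fun z : Plane => ((z, (⟨R, hR⟩, ⟨v, hv⟩)) : Params)) ⁻¹' boxParams w k) =
      rotatedCoord v ⁻¹' Set.pi Set.univ (fun i => Set.Ioo
        (rotatedCoord v w i - k * ![R, 1] i) (rotatedCoord v w i + k * ![R, 1] i)) := by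
    ext z
    simp only [boxParams, rotatedCoord, Set.mem_preimage, Set.mem_ofPred_eq, Set.mem_pi,
      Set.mem_univ, true_imp_iff, Fin.forall_fin_two, Set.mem_Ioo, abs_lt, Matrix.cons_val_zero,
      Matrix.cons_val_one, mul_one]
    constructor <;> rintro ⟨⟨h1, h2⟩, h3, h4⟩ <;>
      refine ⟨⟨?_, ?_⟩, ?_, ?_⟩ <;> linarith
  rw [hset, (measurePreserving_rotatedCoord v).measure_preimage
    (MeasurableSet.univ_pi fun i => measurableSet_Ioo).nullMeasurableSet, Real.volume_pi_Ioo]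
  simp only [Fin.prod_univ_two, Matrix.cons_val_zero, Matrix.cons_val_one]
  rw [mul_right_comm, ← ENNReal.ofReal_mul' hR0]
  congr 2 <;> ring

instance : IsProbabilityMeasure directionLaw := by
  refine ⟨?_⟩
  rw [directionLaw, Measure.smul_apply, (MeasurableEmbedding.subtype_coe
    measurableSet_Ioc).comap_apply, Set.image_univ, Subtype.range_coe, Real.volume_Ioc,
    show Real.pi / 2 - -(Real.pi / 2) = Real.pi by ring, smul_eq_mul]
  exact ENNReal.inv_mul_cancel (by simpa using Real.pi_pos) ENNReal.ofReal_ne_top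

theorem intensity_boxParams (u : ℝ) (ρ : Measure (Set.Ici (1 : ℝ))) [IsProbabilityMeasure ρ]
    (w : Plane) (k : ℝ) :
    intensity u ρ (boxParams w k) = ENNReal.ofReal u *
      (ENNReal.ofReal (2 * k) * ENNReal.ofReal (2 * k)) * ∫⁻ R, ENNReal.ofReal (R : ℝ) ∂ρ := by
  rw [intensity, Measure.prod_apply_symm (isOpen_boxParams w k).measurableSet]
  simp only [Measure.smul_apply, smul_eq_mul, volume_boxParams_section, ← mul_assoc]
  have hm : Measurable fun t : Set.Ici (1 : ℝ) × Set.Ioc (-(Real.pi / 2)) (Real.pi / 2) =>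
    ENNReal.ofReal (t.1 : ℝ) := by fun_prop
  rw [lintegral_const_mul _ hm, lintegral_prod _ hm.aemeasurable]
  simp

/-- By the layer-cake formula the mean is the integral of the tail `ρ[t, ∞)` over `t > 0`. The part
`t ≤ 1` contributes at most 1, and beyond it the tail is comparable to `t ^ (-α)`. -/
theorem HasTailDecay.lintegral_lt_top_iff {ρ : Measure (Set.Ici (1 : ℝ))}
    [IsProbabilityMeasure ρ] {α : ℝ} (hρ : HasTailDecay ρ α) :
    ∫⁻ R, ENNReal.ofReal (R : ℝ) ∂ρ < ∞ ↔ 1 < α := by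
  obtain ⟨c, hc, h⟩ := hρ
  rw [lintegral_eq_lintegral_meas_le ρ
    (Filter.Eventually.of_forall fun R => zero_le_one.trans R.2) (by fun_prop)]
  have hnn : ∀ b : ℝ, 0 < b → 0 ≤ᵐ[volume.restrict (Set.Ioi (1 : ℝ))] fun t => b * t ^ (-α) :=
    fun b hb => ae_restrict_of_forall_mem measurableSet_Ioi fun t ht =>
      mul_nonneg hb.le (Real.rpow_nonneg (zero_le_one.trans (le_of_lt ht)) _)
  have hsm : ∀ b : ℝ, AEStronglyMeasurable (fun t : ℝ => b * t ^ (-α))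
      (volume.restrict (Set.Ioi (1 : ℝ))) := fun b => by
    have : Measurable fun t : ℝ => b * t ^ (-α) := by fun_prop
    exact this.aestronglyMeasurable
  constructor
  · intro hlt
    have hle : ∫⁻ t in Set.Ioi (1 : ℝ), ENNReal.ofReal (c⁻¹ * t ^ (-α)) < ∞ := by
      refine lt_of_le_of_lt ?_ hlt
      refine (setLIntegral_mono' measurableSet_Ioi fun t ht => ?_).trans
        (lintegral_mono_set (Set.Ioi_subset_Ioi zero_le_one))
      exact (ENNReal.ofReal_le_iff_le_toReal (measure_ne_top _ _)).2 (h t (le_of_lt ht)).1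
    have hint : IntegrableOn (fun t : ℝ => c⁻¹ * t ^ (-α)) (Set.Ioi 1) :=
      ⟨hsm _, (hasFiniteIntegral_iff_ofReal (hnn _ (inv_pos.2 hc))).2 hle⟩
    have hint' : IntegrableOn (fun t : ℝ => t ^ (-α)) (Set.Ioi 1) := by
      refine (integrable_const_mul_iff (isUnit_iff_ne_zero.2 (inv_ne_zero hc.ne')) _).1 hint
    linarith [(integrableOn_Ioi_rpow_iff zero_lt_one).1 hint']
  · intro hα
    have hint : IntegrableOn (fun t : ℝ => c * t ^ (-α)) (Set.Ioi 1) :=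
      (integrableOn_Ioi_rpow_of_lt (by linarith) zero_lt_one).const_mul c
    rw [← Set.Ioc_union_Ioi_eq_Ioi (zero_le_one (α := ℝ))]
    refine (lintegral_union_le _ _ _).trans_lt (ENNReal.add_lt_top.2 ⟨?_, ?_⟩)
    · refine (setLIntegral_mono measurable_const fun t _ => prob_le_one).trans_lt ?_
      simp
    · refine (setLIntegral_mono' measurableSet_Ioi fun t ht => ?_).trans_lt
        ((hasFiniteIntegral_iff_ofReal (hnn c hc)).1 hint.2)
      exact (ENNReal.le_ofReal_iff_toReal_le (measure_ne_top _ _)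
        (mul_nonneg hc.le (Real.rpow_nonneg (zero_le_one.trans (le_of_lt ht)) _))).2
        (h t (le_of_lt ht)).2

/-- Any factor above 1 would do: it fits the closed ellipse condition into an open box. -/
theorem mem_boxParams_of_mem_ellipse {w : Plane} {s : Params} (h : w ∈ ellipse s) :
    s ∈ boxParams w 2 := by
  obtain ⟨z, ⟨R, hR⟩, v⟩ := s
  have hR1 : (1 : ℝ) ≤ R := hR
  simp only [ellipse, Set.mem_ofPred_eq] at h
  simp only [boxParams, Set.mem_ofPred_eq]
  have hb := sq_nonneg (-(w 0 - z 0) * Real.sin v + (w 1 - z 1) * Real.cos v)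
  have ha := sq_nonneg (((w 0 - z 0) * Real.cos v + (w 1 - z 1) * Real.sin v) / R)
  constructor
  · have h1 := (sq_le_one_iff_abs_le_one _).1
      (by linarith : (((w 0 - z 0) * Real.cos v + (w 1 - z 1) * Real.sin v) / R) ^ 2 ≤ 1)
    rw [abs_div, abs_of_pos (by linarith : (0 : ℝ) < R), div_le_one (by linarith)] at h1
    linarith
  · have h1 := (sq_le_one_iff_abs_le_one _).1
      (by linarith : (-(w 0 - z 0) * Real.sin v + (w 1 - z 1) * Real.cos v) ^ 2 ≤ 1)
    linarith

/-- In the rotated frame the offsets from the center are at most `1/4 + R/4 ≤ R/2` and `1/4 + 1/4 =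
1/2`, so the normalized squares sum to at most `1/2`. -/
theorem closedBall_subset_ellipse {w : Plane} {s : Params} (h : s ∈ boxParams w (1 / 4)) :
    Metric.closedBall w (1 / 4) ⊆ ellipse s := by
  intro x hx
  obtain ⟨z, ⟨R, hR⟩, v, hv⟩ := s
  have hR1 : (1 : ℝ) ≤ R := hR
  simp only [boxParams, Set.mem_ofPred_eq] at h
  simp only [ellipse, Set.mem_ofPred_eq]
  rw [Metric.mem_closedBall, EuclideanSpace.dist_eq, Real.sqrt_le_left (by norm_num),
    Fin.sum_univ_two, Real.dist_eq, Real.dist_eq, sq_abs, sq_abs] at hx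
  have hrot : ((x 0 - w 0) * Real.cos v + (x 1 - w 1) * Real.sin v) ^ 2 +
      (-(x 0 - w 0) * Real.sin v + (x 1 - w 1) * Real.cos v) ^ 2 ≤ (1 / 4) ^ 2 := by
    refine le_of_eq_of_le ?_ hx
    linear_combination ((x 0 - w 0) ^ 2 + (x 1 - w 1) ^ 2) * Real.sin_sq_add_cos_sq v
  have ha : |(x 0 - w 0) * Real.cos v + (x 1 - w 1) * Real.sin v| ≤ 1 / 4 :=
    abs_le_of_sq_le_sq ((le_add_of_nonneg_right (sq_nonneg _)).trans hrot) (by norm_num)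
  have hb : |-(x 0 - w 0) * Real.sin v + (x 1 - w 1) * Real.cos v| ≤ 1 / 4 :=
    abs_le_of_sq_le_sq ((le_add_of_nonneg_left (sq_nonneg _)).trans hrot) (by norm_num)
  obtain ⟨h1, h2⟩ := h
  rw [abs_lt] at h1 h2
  rw [abs_le] at ha hb
  have hA : (((x 0 - z 0) * Real.cos v + (x 1 - z 1) * Real.sin v) / R) ^ 2 ≤ (1 / 2) ^ 2 := by
    rw [← sq_abs]
    refine pow_le_pow_left₀ (abs_nonneg _) ?_ 2
    rw [abs_div, abs_of_pos (by linarith : (0 : ℝ) < R), div_le_iff₀ (by linarith), abs_le]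
    constructor <;> linarith
  have hB : (-(x 0 - z 0) * Real.sin v + (x 1 - z 1) * Real.cos v) ^ 2 ≤ (1 / 2) ^ 2 := by
    rw [← sq_abs]
    refine pow_le_pow_left₀ (abs_nonneg _) ?_ 2
    rw [abs_le]
    constructor <;> linarith
  norm_num at hA hB ⊢
  linarith

theorem IsPoissonPointProcess.ae_closedBall_subset_coveredSet {Ω : Type*} [MeasurableSpace Ω]
    {P : Measure Ω} {u : ℝ} (hu : 0 < u) {α : ℝ} (hα : α ≤ 1) {ρ : Measure (Set.Ici (1 : ℝ))}
    [IsProbabilityMeasure ρ] (hρ : HasTailDecay ρ α) {ξ : Ω → Measure Params}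
    (hξ : IsPoissonPointProcess ξ (intensity u ρ) P) (w : Plane) :
    ∀ᵐ ω ∂P, Metric.closedBall w (1 / 4) ⊆ coveredSet (ξ ω) := by
  have htop : ∫⁻ R, ENNReal.ofReal (R : ℝ) ∂ρ = ∞ := by
    by_contra hne
    exact absurd (hρ.lintegral_lt_top_iff.1 (lt_top_iff_ne_top.2 hne)) (not_lt.2 hα)
  have hint : intensity u ρ (boxParams w (1 / 4)) = ∞ := by
    rw [intensity_boxParams, htop]
    refine ENNReal.mul_top (mul_ne_zero ?_ (mul_ne_zero ?_ ?_)) <;> simp [hu]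
  filter_upwards [hξ.eq_top_of_infinite _ (isOpen_boxParams w _).measurableSet hint] with ω hω
  obtain ⟨s, hs, hsupp⟩ := Measure.nonempty_inter_support_of_pos
    (by rw [hω]; exact ENNReal.zero_lt_top : 0 < ξ ω (boxParams w (1 / 4)))
  exact (closedBall_subset_ellipse hs).trans (Set.subset_biUnion_of_mem (u := ellipse) hsupp)

/-- The radius `1/4` does not depend on the center, so balls around a countable dense set suffice,
at the cost of countably many null events. -/
theorem IsPoissonPointProcess.ae_coveredSet_eq_univ {Ω : Type*} [MeasurableSpace Ω]
    {P : Measure Ω} {u : ℝ} (hu : 0 < u) {α : ℝ} (hα : α ≤ 1) {ρ : Measure (Set.Ici (1 : ℝ))}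
    [IsProbabilityMeasure ρ] (hρ : HasTailDecay ρ α) {ξ : Ω → Measure Params}
    (hξ : IsPoissonPointProcess ξ (intensity u ρ) P) :
    ∀ᵐ ω ∂P, coveredSet (ξ ω) = Set.univ := by
  filter_upwards [ae_all_iff.2 fun n =>
    hξ.ae_closedBall_subset_coveredSet hu hα hρ (TopologicalSpace.denseSeq Plane n)] with ω hω
  refine Set.eq_univ_of_forall fun x => ?_
  obtain ⟨n, hn⟩ := (TopologicalSpace.denseRange_denseSeq Plane).exists_dist_lt x
    (by norm_num : (0 : ℝ) < 1 / 4)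
  exact hω n (Metric.mem_closedBall.2 hn.le)

/-- A Poisson point process avoids a set of finite intensity with positive probability. -/
theorem IsPoissonPointProcess.measure_void_ne_zero {Ω X : Type*} [MeasurableSpace Ω]
    [TopologicalSpace X] [MeasurableSpace X] {P : Measure Ω} {μ : Measure X} {ξ : Ω → Measure X}
    (hξ : IsPoissonPointProcess ξ μ P) {B : Set X} (hB : MeasurableSet B) (hfin : μ B ≠ ∞) :
    P {ω | ξ ω B = 0} ≠ 0 := by
  have hmeas : Measurable fun ω => ξ ω B := (Measure.measurable_coe hB).comp hξ.measurable
  have hlaw := congrArg (fun m : Measure ℝ≥0∞ => m {0}) (hξ.law_of_finite B hB hfin)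
  simp only [Measure.map_apply hmeas (measurableSet_singleton _),
    Measure.map_apply (measurable_from_top (f := fun k : ℕ => (k : ℝ≥0∞)))
      (measurableSet_singleton _)] at hlaw
  have hpre : (fun k : ℕ => (k : ℝ≥0∞)) ⁻¹' {0} = {0} := by ext; simp
  rw [hpre, poissonMeasure_singleton] at hlaw
  change P ((fun ω => ξ ω B) ⁻¹' {0}) ≠ 0
  -- The void probability is `exp (-μ B)`.
  rw [hlaw]
  simp [Real.exp_pos]

theorem IsPoissonPointProcess.le_one_of_ae_mem_coveredSet {Ω : Type*} [MeasurableSpace Ω]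
    {P : Measure Ω} {u α : ℝ} {ρ : Measure (Set.Ici (1 : ℝ))} [IsProbabilityMeasure ρ]
    (hρ : HasTailDecay ρ α) {ξ : Ω → Measure Params}
    (hξ : IsPoissonPointProcess ξ (intensity u ρ) P) {w : Plane}
    (hw : ∀ᵐ ω ∂P, w ∈ coveredSet (ξ ω)) : α ≤ 1 := by
  by_contra! hα
  have hfin : intensity u ρ (boxParams w 2) ≠ ∞ := by
    rw [intensity_boxParams]
    exact ENNReal.mul_ne_top (by finiteness) (hρ.lintegral_lt_top_iff.2 hα).ne
  refine hξ.measure_void_ne_zero (isOpen_boxParams w 2).measurableSet hfin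
    (measure_mono_null ?_ (ae_iff.1 hw))
  -- If the box has no mass, `w` is uncovered: a support point in this open box would give it
  -- positive mass.
  intro ω hω hcov
  obtain ⟨s, hs, hws⟩ := Set.mem_iUnion₂.1 hcov
  exact ((Measure.mem_support_iff_forall s).1 hs _
    ((isOpen_boxParams w 2).mem_nhds (mem_boxParams_of_mem_ellipse hws))).ne' hω

end EllipsesModel

theorem mainTheorem4 {Ω : Type*} [MeasurableSpace Ω] (P : Measure Ω) [IsProbabilityMeasure P]
    (u : ℝ) (hu : 0 < u) (α : ℝ) (hα : 0 < α)
    (ρ : Measure (Set.Ici (1 : ℝ))) [IsProbabilityMeasure ρ]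
    (hρ : EllipsesModel.HasTailDecay ρ α)
    (ξ : Ω → Measure EllipsesModel.Params)
    (hξ : EllipsesModel.IsPoissonPointProcess ξ (EllipsesModel.intensity u ρ) P) :
    ((∀ᵐ ω ∂P, EllipsesModel.coveredSet (ξ ω) = Set.univ) ↔ α ≤ 1) ∧
    (∀ (w : EllipsesModel.Plane) (ε : ℝ), 0 ≤ ε → ε < 1 / 2 →
      ((∀ᵐ ω ∂P, Metric.closedBall w ε ⊆ EllipsesModel.coveredSet (ξ ω)) ↔ α ≤ 1)) := by
  refine ⟨⟨fun h => hξ.le_one_of_ae_mem_coveredSet hρ (w := 0) ?_,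
    fun h => hξ.ae_coveredSet_eq_univ hu h hρ⟩, fun w ε hε _ => ⟨fun h =>
      hξ.le_one_of_ae_mem_coveredSet hρ (w := w) ?_, fun h => ?_⟩⟩
  · filter_upwards [h] with ω hω
    exact hω ▸ Set.mem_univ _
  · filter_upwards [h] with ω hω
    exact hω (Metric.mem_closedBall_self hε)
  · filter_upwards [hξ.ae_coveredSet_eq_univ hu h hρ] with ω hω
    exact hω ▸ Set.subset_univ _
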